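/- Let $k$ be a field, let $n\ge 0$ be an integer, and let $\mathcal P=(p_{ij})$ be an $n\times n$ matrix with entries in $k^\times$ such that $p_{ii}=1$ and $p_{ij}p_{ji}=1$ for all $1\le i,j\le n$. Let $S_{\mathcal P}=k_{\mathcal P}[x_1,\dots,x_n]$ be the skew polynomial ring, that is, the unital associative $k$-algebra generated by $x_1,\dots,x_n$ subject to the relations $x_jx_i=p_{ij}x_ix_j$ for all $1\le i,j\le n$. Then $S_{\mathcal P}$ is a noetherian unique factorization ring (noetherian UFR): it is a left and right noetherian prime ring, and every nonzero prime ideal of $S_{\mathcal P}$ contains a nonzero principal prime ideal. Here ideals are two-sided; an ideal $P$ of a ring $A$ is prime if $P\ne A$ and, for all $a,b\in A$, $aAb\subseteq P$ implies $a\in P$ or $b\in P$; a ring is prime if its zero ideal is prime; and an ideal is principal if it is generated by a normal element, i.e. by an element $a$ with $Aa=aA$. -/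

import Mathlib

/-- The defining relations `x_j x_i = p_{ij} x_i x_j` on the free algebra `k⟨x_1, …, x_n⟩`. -/
inductive SkewPolyRel {k : Type*} [Field k] {n : ℕ} (P : Matrix (Fin n) (Fin n) kˣ) :
    FreeAlgebra k (Fin n) → FreeAlgebra k (Fin n) → Prop
  | comm (i j : Fin n) :
      SkewPolyRel P (FreeAlgebra.ι k j * FreeAlgebra.ι k i)
        ((P i j : k) • (FreeAlgebra.ι k i * FreeAlgebra.ι k j))

/-- The skew polynomial ring `k_P[x_1, …, x_n]`: the `k`-algebra generated by `x_1, …, x_n`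
subject to `x_j x_i = p_{ij} x_i x_j` for all `i, j`. -/
abbrev SkewPolyRing (k : Type*) [Field k] {n : ℕ} (P : Matrix (Fin n) (Fin n) kˣ) : Type _ :=
  RingQuot (SkewPolyRel P)

section UFR

variable {A : Type*} [Ring A]

/-- `a` is a normal element: `Aa = aA`. -/
def IsNormalElem (a : A) : Prop :=
  {x : A | ∃ r : A, x = r * a} = {x : A | ∃ r : A, x = a * r}

namespace TwoSidedIdeal

/-- A (two-sided) ideal generated by a normal element. -/
def IsNormalPrincipal (I : TwoSidedIdeal A) : Prop :=
  ∃ a : A, IsNormalElem a ∧ I = TwoSidedIdeal.span {a}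

/-- Prime ideals of a noncommutative ring: `P` is proper, and `a A b ⊆ P` implies
`a ∈ P` or `b ∈ P`. -/
def IsPrimeIdeal (P : TwoSidedIdeal A) : Prop :=
  P ≠ ⊤ ∧ ∀ a b : A, (∀ r : A, a * r * b ∈ P) → a ∈ P ∨ b ∈ P

end TwoSidedIdeal

end UFR

/-- A noetherian unique factorization ring: a (left and right) noetherian prime ring in which
every nonzero prime ideal contains a nonzero principal prime ideal. -/
structure IsNoetherianUFR (A : Type*) [Ring A] : Prop where
  left_noetherian : IsNoetherianRing A
  right_noetherian : IsNoetherianRing Aᵐᵒᵖ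
  prime_ring : (⊥ : TwoSidedIdeal A).IsPrimeIdeal
  exists_principal_prime : ∀ P : TwoSidedIdeal A, P.IsPrimeIdeal → P ≠ ⊥ →
    ∃ Q : TwoSidedIdeal A, Q.IsPrimeIdeal ∧ Q ≠ ⊥ ∧ Q.IsNormalPrincipal ∧ Q ≤ P

/-! The skew polynomial ring `S` sits in a quantum torus `T` with basis `x^a`, `a ∈ ℤⁿ`, as the span
of the monomials with nonnegative exponents. In `T` monomials are units and multiply by a
bicharacter, so everything reduces to exponents.

Noetherianity is Dickson's lemma applied to leading exponents; swapping the arguments of the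
bicharacter handles the opposite ring. Products of nonzero elements are nonzero because lowest terms
multiply, so `S` is prime.

Let `P` be a nonzero prime. If it contains some `x_i`, then `(x_i)` is the required ideal, since the
minimal `i`-th exponent is additive on products. Otherwise `P` contains no monomial and is stable
under conjugation by monomials. Conjugation acts diagonally and separates exponents modulo the
lattice of central ones (`exists_supportedOn`), so `P` contains a nonzero element `x^e p`, with `p`
a polynomial in central monomials. That polynomial ring is a UFD and `P` is prime, so `p` may be
taken to be a prime `q`. Shifting `q` by a monomial so that no `x_i` divides it gives a normal `s ∈
P` with `sS = S ∩ qT` (`mem_span_iff_of_normalized`). The ideal `qT` is prime by the same separation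
argument (`mem_range_or_mem_range`), hence so is `sS`. -/

open Module

/-! ### Twisted monoid algebras and their extreme terms -/

/-- A basis of an algebra, indexed by a commutative monoid, whose elements multiply according to
a bicharacter: the algebra is then a twisted monoid algebra. -/
structure BicharBasis (k M A : Type*) [Field k] [AddCommMonoid M] [Ring A] [Algebra k A] where
  basis : Basis M k A
  bichar : M → M → kˣ
  bichar_add_left : ∀ a b c, bichar (a + b) c = bichar a c * bichar b c
  bichar_add_right : ∀ a b c, bichar a (b + c) = bichar a b * bichar a c
  mul_basis : ∀ a b, basis a * basis b = (bichar a b : k) • basis (a + b)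

namespace BicharBasis

variable {k M A : Type*} [Field k] [AddCommMonoid M] [Ring A] [Algebra k A]
  (B : BicharBasis k M A)

theorem bichar_zero_left (a : M) : B.bichar 0 a = 1 := by
  have h := B.bichar_add_left 0 0 a
  rw [add_zero] at h
  exact (mul_eq_left.mp h.symm)

theorem bichar_zero_right (a : M) : B.bichar a 0 = 1 := by
  have h := B.bichar_add_right a 0 0
  rw [add_zero] at h
  exact (mul_eq_left.mp h.symm)

theorem basis_zero : B.basis 0 = 1 := by
  have h : LinearMap.mulLeft k (B.basis 0) = LinearMap.id := by
    refine B.basis.ext fun a => ?_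
    simp [B.mul_basis, B.bichar_zero_left]
  simpa using LinearMap.congr_fun h 1

/-- The basis `op (b a)` of the opposite algebra. -/
noncomputable def op : BicharBasis k M Aᵐᵒᵖ where
  basis := B.basis.map (MulOpposite.opLinearEquiv k)
  bichar a b := B.bichar b a
  bichar_add_left a b c := B.bichar_add_right c a b
  bichar_add_right a b c := B.bichar_add_left b c a
  mul_basis a b := by
    simp [← MulOpposite.op_mul, B.mul_basis, add_comm]

theorem basis_mul_comm (a b : M) :
    B.basis a * B.basis b = ((B.bichar a b / B.bichar b a : kˣ) : k) • (B.basis b * B.basis a) := by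
  rw [B.mul_basis, B.mul_basis, smul_smul, add_comm b a, ← Units.val_mul, div_mul_cancel]

theorem repr_mul [DecidableEq M] (f g : A) (d : M) :
    B.basis.repr (f * g) d = ∑ a ∈ (B.basis.repr f).support, ∑ b ∈ (B.basis.repr g).support,
      if a + b = d then B.bichar a b * B.basis.repr f a * B.basis.repr g b else 0 := by
  conv_lhs => rw [← B.basis.linearCombination_repr f, ← B.basis.linearCombination_repr g]
  simp only [Finsupp.linearCombination_apply, Finsupp.sum, Finset.sum_mul_sum, map_sum,
    Finsupp.finsetSum_apply, smul_mul_smul_comm, B.mul_basis, map_smul, Finsupp.smul_apply,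
    Basis.repr_self, Finsupp.single_apply, smul_eq_mul]
  refine Finset.sum_congr rfl fun a _ => Finset.sum_congr rfl fun b _ => ?_
  split_ifs <;> ring

theorem exists_of_repr_mul_ne_zero {f g : A} {d : M} (h : B.basis.repr (f * g) d ≠ 0) :
    ∃ a b, B.basis.repr f a ≠ 0 ∧ B.basis.repr g b ≠ 0 ∧ a + b = d := by
  classical
  rw [B.repr_mul] at h
  obtain ⟨a, ha, h⟩ := Finset.exists_ne_zero_of_sum_ne_zero h
  obtain ⟨b, hb, h⟩ := Finset.exists_ne_zero_of_sum_ne_zero h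
  refine ⟨a, b, by simpa using ha, by simpa using hb, ?_⟩
  by_contra hab
  simp [hab] at h

theorem repr_mul_of_unique {f g : A} {a b : M}
    (h : ∀ a' b', B.basis.repr f a' ≠ 0 → B.basis.repr g b' ≠ 0 → a' + b' = a + b →
      a' = a ∧ b' = b) :
    B.basis.repr (f * g) (a + b) = B.bichar a b * B.basis.repr f a * B.basis.repr g b := by
  classical
  rw [B.repr_mul, Finset.sum_eq_single a, Finset.sum_eq_single b]
  · simp
  · intro b' hb' hne
    by_cases ha : B.basis.repr f a = 0
    · simp [ha]
    · rw [if_neg]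
      intro hab
      exact hne (h a b' ha (by simpa using hb') hab).2
  · intro hb
    have : B.basis.repr g b = 0 := by simpa using hb
    simp [this]
  · intro a' ha' hne
    refine Finset.sum_eq_zero fun b' hb' => if_neg fun hab => ?_
    exact hne (h a' b' (by simpa using ha') (by simpa using hb') hab).1
  · intro ha
    have : B.basis.repr f a = 0 := by simpa using ha
    simp [this]

theorem repr_basis_mul [IsCancelAdd M] (c : M) (f : A) (a : M) :
    B.basis.repr (B.basis c * f) (c + a) = B.bichar c a * B.basis.repr f a := by
  classical
  rw [B.repr_mul_of_unique]
  · simp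
  · intro a' b' ha' _ hab
    have : c = a' := by
      by_contra hne
      simp [hne] at ha'
    subst this
    exact ⟨rfl, add_left_cancel hab⟩

theorem repr_mul_basis [IsCancelAdd M] (c : M) (f : A) (a : M) :
    B.basis.repr (f * B.basis c) (a + c) = B.bichar a c * B.basis.repr f a := by
  classical
  rw [B.repr_mul_of_unique]
  · simp
  · intro a' b' _ hb' hab
    have : c = b' := by
      by_contra hne
      simp [hne] at hb'
    subst this
    exact ⟨add_right_cancel hab, rfl⟩

theorem exists_of_repr_basis_mul_ne_zero {c : M} {f : A} {d : M}
    (h : B.basis.repr (B.basis c * f) d ≠ 0) : ∃ a, B.basis.repr f a ≠ 0 ∧ c + a = d := by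
  classical
  obtain ⟨a, b, ha, hb, hab⟩ := B.exists_of_repr_mul_ne_zero h
  have : c = a := by
    by_contra hne
    simp [hne] at ha
  subst this
  exact ⟨b, hb, hab⟩

theorem exists_min_image_repr {L : Type*} [LinearOrder L] {f : A} (hf : f ≠ 0) (ψ : M → L) :
    ∃ a, B.basis.repr f a ≠ 0 ∧ ∀ b, B.basis.repr f b ≠ 0 → ψ a ≤ ψ b := by
  have hne : (B.basis.repr f).support.Nonempty := by
    rw [Finsupp.support_nonempty_iff]
    simpa using hf
  obtain ⟨a, ha, h⟩ := Finset.exists_min_image _ ψ hne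
  exact ⟨a, by simpa using ha, fun b hb => h b (by simpa using hb)⟩

/-- The sum of two minimal exponents arises in only one way, so nothing can cancel that term. -/
theorem repr_mul_ne_zero_of_min {L : Type*} [AddCommMonoid L] [LinearOrder L]
    [IsOrderedCancelAddMonoid L] (ψ : M →+ L) (hψ : Function.Injective ψ) {f g : A} {a b : M}
    (ha : B.basis.repr f a ≠ 0) (ha' : ∀ c, B.basis.repr f c ≠ 0 → ψ a ≤ ψ c)
    (hb : B.basis.repr g b ≠ 0) (hb' : ∀ c, B.basis.repr g c ≠ 0 → ψ b ≤ ψ c) :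
    B.basis.repr (f * g) (a + b) ≠ 0 := by
  rw [B.repr_mul_of_unique]
  · simp [ha, hb]
  · intro c d hc hd hcd
    have h : ψ c + ψ d = ψ a + ψ b := by rw [← map_add, hcd, map_add]
    obtain ⟨h1, h2⟩ := (add_eq_add_iff_eq_and_eq (ha' c hc) (hb' d hd)).mp h.symm
    exact ⟨hψ h1.symm, hψ h2.symm⟩

/-! ### Noetherianity through leading exponents -/

section Noetherian

variable {n : ℕ} (B : BicharBasis k (Fin n → ℕ) A)

/-- `a` is the lexicographically largest exponent of `f`. -/
def IsLeadingExp (f : A) (a : Fin n → ℕ) : Prop :=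
  B.basis.repr f a ≠ 0 ∧ ∀ b, B.basis.repr f b ≠ 0 → toLex b ≤ toLex a

theorem exists_isLeadingExp {f : A} (hf : f ≠ 0) : ∃ a, B.IsLeadingExp f a := by
  have hne : (B.basis.repr f).support.Nonempty := by
    rw [Finsupp.support_nonempty_iff]
    simpa using hf
  obtain ⟨a, ha, h⟩ := Finset.exists_max_image _ toLex hne
  exact ⟨a, by simpa using ha, fun b hb => h b (by simpa using hb)⟩

/-- The exponents of the leading monomials of a left ideal. -/
def leadingExps (I : Submodule A A) : Set (Fin n → ℕ) :=
  {a | ∃ f ∈ I, B.IsLeadingExp f a}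

theorem leadingExps_mono {I J : Submodule A A} (h : I ≤ J) : B.leadingExps I ⊆ B.leadingExps J :=
  fun _ ⟨f, hf, hfa⟩ => ⟨f, h hf, hfa⟩

theorem isUpperSet_leadingExps (I : Submodule A A) : IsUpperSet (B.leadingExps I) := by
  rintro a b hab ⟨f, hf, hfa, hmax⟩
  obtain ⟨c, rfl⟩ := exists_add_of_le hab
  refine ⟨B.basis c * f, I.smul_mem _ hf, ?_, ?_⟩
  · rw [add_comm, B.repr_basis_mul]
    simpa using hfa
  · intro d hd
    obtain ⟨e, he, rfl⟩ := B.exists_of_repr_basis_mul_ne_zero hd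
    rw [add_comm a c, toLex_add, toLex_add]
    exact add_le_add_right (hmax e he) _

/-- Division algorithm: subtracting an element of `I` with the same leading term lowers the leading
exponent, and the lexicographic order on `ℕⁿ` is well-founded. -/
theorem le_of_leadingExps_subset {I J : Submodule A A} (hIJ : I ≤ J)
    (h : B.leadingExps J ⊆ B.leadingExps I) : J ≤ I := by
  have key : ∀ a : Lex (Fin n → ℕ), ∀ f ∈ J, B.IsLeadingExp f (ofLex a) → f ∈ I := by
    intro a
    induction a using WellFoundedLT.induction with
    | ind a ih =>
      intro f hf hfa
      obtain ⟨g, hg, hga⟩ := h ⟨f, hf, hfa⟩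
      set c := B.basis.repr f (ofLex a) / B.basis.repr g (ofLex a) with hc
      have hcg : c • g ∈ I := Submodule.smul_of_tower_mem I c hg
      suffices f - c • g ∈ I by simpa using I.add_mem this hcg
      by_cases h0 : f - c • g = 0
      · simp [h0]
      obtain ⟨b, hb⟩ := B.exists_isLeadingExp h0
      refine ih (toLex b) (lt_of_le_of_ne ?_ ?_) _ (J.sub_mem hf (hIJ hcg)) hb
      · by_cases hfb : B.basis.repr f b = 0
        · refine hga.2 b fun hgb => hb.1 ?_
          simp [hfb, hgb]
        · exact hfa.2 b hfb
      · rintro rfl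
        apply hb.1
        have := hga.1
        simp only [ofLex_toLex] at this hc ⊢
        simp [hc, this]
  intro f hf
  by_cases h0 : f = 0
  · simp [h0]
  obtain ⟨a, ha⟩ := B.exists_isLeadingExp h0
  exact key (toLex a) f hf ha

theorem isNoetherianRing (B : BicharBasis k (Fin n → ℕ) A) : IsNoetherianRing A := by
  rw [isNoetherianRing_iff, ← monotone_stabilizes_iff_noetherian]
  intro I
  by_contra! hI
  have step : ∀ m, ∃ m' , m ≤ m' ∧ ∃ a, a ∈ B.leadingExps (I m') ∧ a ∉ B.leadingExps (I m) := by
    intro m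
    obtain ⟨m', hm, hne⟩ := hI m
    refine ⟨m', hm, ?_⟩
    by_contra! hcon
    exact hne (le_antisymm (I.monotone hm) (B.le_of_leadingExps_subset (I.monotone hm) hcon))
  choose nx hnx e he he' using step
  let s : ℕ → ℕ := fun j => nx^[j] 0
  have hs : Monotone s := monotone_nat_of_le_succ fun j => by
    simp only [s, Function.iterate_succ_apply']
    exact hnx _
  -- Dickson's lemma: some new leading exponent dominates an earlier one, so it already belonged to
  -- the upper set it was chosen to avoid.
  obtain ⟨i, j, hij, hle⟩ := (wellQuasiOrdered_le (α := Fin n → ℕ)) (fun j => e (s j))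
  refine he' (s j) (B.isUpperSet_leadingExps _ hle (B.leadingExps_mono (I.monotone ?_) (he (s i))))
  have : s (i + 1) ≤ s j := hs hij
  simpa only [s, Function.iterate_succ_apply'] using this

end Noetherian

end BicharBasis

/-! ### Conjugation by monomials and central exponents -/

namespace BicharBasis

variable {k G T : Type*} [Field k] [AddCommGroup G] [Ring T] [Algebra k T]
  (B : BicharBasis k G T)

theorem bichar_neg_right (a b : G) : B.bichar a (-b) = (B.bichar a b)⁻¹ := by
  rw [eq_inv_iff_mul_eq_one, ← B.bichar_add_right, neg_add_cancel, B.bichar_zero_right]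

theorem bichar_neg_left (a b : G) : B.bichar (-a) b = (B.bichar a b)⁻¹ := by
  rw [eq_inv_iff_mul_eq_one, ← B.bichar_add_left, neg_add_cancel, B.bichar_zero_left]

theorem exists_basis_mul_neg (a : G) : ∃ u : kˣ, B.basis a * B.basis (-a) = algebraMap k T u :=
  ⟨B.bichar a (-a), by rw [B.mul_basis, add_neg_cancel, B.basis_zero, Algebra.algebraMap_eq_smul_one]⟩

theorem exists_basis_mul_eq_one (a : G) : ∃ t, B.basis a * t = 1 := by
  refine ⟨((B.bichar a (-a))⁻¹ : kˣ) • B.basis (-a), ?_⟩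
  rw [mul_smul_comm, B.mul_basis, add_neg_cancel, B.basis_zero, ← Units.smul_def, inv_smul_smul]

/-- The exponents whose basis elements are central. -/
def centralExps : Submodule ℤ G :=
  AddSubgroup.toIntSubmodule
    { carrier := {a | ∀ b, B.bichar a b = B.bichar b a}
      add_mem' := fun {a b} ha hb c => by
        rw [B.bichar_add_left, B.bichar_add_right, ha c, hb c]
      zero_mem' := fun b => by rw [B.bichar_zero_left, B.bichar_zero_right]
      neg_mem' := fun {a} ha b => by rw [B.bichar_neg_left, B.bichar_neg_right, ha b] }

theorem basis_mem_center {a : G} (ha : a ∈ B.centralExps) :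
    B.basis a ∈ Subalgebra.center k T := by
  rw [Subalgebra.mem_center_iff]
  intro t
  have h : LinearMap.mulRight k (B.basis a) = LinearMap.mulLeft k (B.basis a) := by
    refine B.basis.ext fun b => ?_
    simp only [LinearMap.mulRight_apply, LinearMap.mulLeft_apply, B.mul_basis, ha b, add_comm]
  exact LinearMap.congr_fun h t

/-- Conjugation is diagonal in the monomial basis. The factor `bichar b (-b)` appears because `basis
(-b)` inverts `basis b` only up to a scalar; it does not depend on `a`. -/
theorem repr_conj (b : G) (y : T) (a : G) :
    B.basis.repr (B.basis b * y * B.basis (-b)) a =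
      B.bichar b (-b) * (B.bichar b a / B.bichar a b : kˣ) * B.basis.repr y a := by
  have h := B.repr_mul_basis (-b) (B.basis b * y) (b + a)
  rw [B.repr_basis_mul, add_neg_cancel_comm] at h
  rw [h, B.bichar_add_left, B.bichar_neg_right a b, div_eq_mul_inv]
  push_cast
  ring

/-- All exponents of `y` are congruent to `d` modulo the central exponents. -/
def SupportedOn (y : T) (d : G) : Prop :=
  ∀ a, B.basis.repr y a ≠ 0 → a - d ∈ B.centralExps

/-- An eigenvector argument by induction on the size of the support. If two exponents differ by a
noncentral one, some conjugation has different eigenvalues on them, and subtracting either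
eigenvalue removes a term while staying in `W`. The set `E` of conjugating exponents is kept general
so that only nonnegative ones need be used. -/
theorem exists_supportedOn (E : AddSubmonoid G)
    (hE : ∀ a, (∀ b ∈ E, B.bichar b a = B.bichar a b) → a ∈ B.centralExps)
    {W W' : Submodule k T} (hW : ∀ b ∈ E, ∀ y ∈ W, B.basis b * y * B.basis (-b) ∈ W)
    {y : T} (hy : y ∈ W) (hy' : y ∉ W') :
    ∃ z ∈ W, z ∉ W' ∧ ∃ d, B.SupportedOn z d := by
  induction hN : (B.basis.repr y).support.card using Nat.strong_induction_on generalizing y with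
  | _ N ih =>
  subst hN
  by_cases hex : ∃ c d, B.basis.repr y c ≠ 0 ∧ B.basis.repr y d ≠ 0 ∧ c - d ∉ B.centralExps
  · obtain ⟨c, d, hc, hd, hcd⟩ := hex
    obtain ⟨b, hb, hne⟩ : ∃ b ∈ E, B.bichar b (c - d) ≠ B.bichar (c - d) b := by
      by_contra! hcon
      exact hcd (hE _ hcon)
    let μ : G → k := fun a => B.bichar b (-b) * (B.bichar b a / B.bichar a b : kˣ)
    have hμ : μ d - μ c ≠ 0 := by
      rw [sub_ne_zero]
      intro h
      have h1 := Units.ext (mul_left_cancel₀ (Units.ne_zero _) h)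
      apply hne
      rw [sub_eq_add_neg, B.bichar_add_left, B.bichar_add_right, B.bichar_neg_left,
        B.bichar_neg_right, ← div_eq_mul_inv, ← div_eq_mul_inv]
      rw [div_eq_div_iff_mul_eq_mul] at h1 ⊢
      rw [← h1, mul_comm]
    let D : G → T := fun e => B.basis b * y * B.basis (-b) - μ e • y
    have hD : ∀ e a, B.basis.repr (D e) a = (μ a - μ e) * B.basis.repr y a := by
      intro e a
      simp only [D, map_sub, map_smul, Finsupp.sub_apply, Finsupp.smul_apply, smul_eq_mul,
        B.repr_conj, μ]
      ring
    have hDW : ∀ e, D e ∈ W := fun e => W.sub_mem (hW b hb y hy) (W.smul_mem _ hy)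
    have hcard : ∀ e, B.basis.repr y e ≠ 0 →
        (B.basis.repr (D e)).support.card < (B.basis.repr y).support.card := by
      intro e he
      refine Finset.card_lt_card ((Finset.ssubset_iff_of_subset ?_).mpr ⟨e, by simpa using he, ?_⟩)
      · intro a ha
        rw [Finsupp.mem_support_iff, hD] at ha
        exact Finsupp.mem_support_iff.mpr (right_ne_zero_of_mul ha)
      · simp [hD]
    by_cases h1 : D c ∈ W'
    -- The two reductions cannot both fall into `W'`, since `D c - D d` is the nonzero multiple `μ d
    -- - μ c` of `y`.
    · by_cases h2 : D d ∈ W'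
      · refine absurd ?_ hy'
        have : y = (μ d - μ c)⁻¹ • (D c - D d) := by
          simp only [D, sub_sub_sub_cancel_left, ← sub_smul]
          rw [inv_smul_smul₀ hμ]
        rw [this]
        exact W'.smul_mem _ (W'.sub_mem h1 h2)
      · exact ih _ (hcard d hd) (hDW d) h2 rfl
    · exact ih _ (hcard c hc) (hDW c) h1 rfl
  · push Not at hex
    by_cases h0 : y = 0
    · exact absurd (h0 ▸ W'.zero_mem) hy'
    obtain ⟨d, hd⟩ : ∃ d, B.basis.repr y d ≠ 0 := by
      by_contra! h
      exact h0 (B.basis.repr.map_eq_zero_iff.mp (Finsupp.ext h))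
    exact ⟨y, hy, hy', d, fun a ha => hex a d ha hd⟩

/-! ### Polynomials in central monomials, and primes of the torus -/

section Center

variable {ι : Type*} (γ : Basis ι ℤ B.centralExps)

/-- The polynomials in a basis of the central exponents, as central elements. -/
noncomputable def centralPoly : MvPolynomial ι k →ₐ[k] T :=
  (Subalgebra.center k T).val.comp
    (MvPolynomial.aeval fun i => ⟨B.basis (γ i : G), B.basis_mem_center (γ i).2⟩)

theorem centralPoly_comm (p : MvPolynomial ι k) (t : T) :
    t * B.centralPoly γ p = B.centralPoly γ p * t :=
  Subalgebra.mem_center_iff.mp (MvPolynomial.aeval _ p : Subalgebra.center k T).2 t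

theorem centralPoly_X (i : ι) : B.centralPoly γ (MvPolynomial.X i) = B.basis (γ i : G) := by
  simp [centralPoly]

/-- The exponent in `G` of a monomial in the central variables. -/
noncomputable def centralExp : (ι →₀ ℕ) →+ G :=
  B.centralExps.subtype.toAddMonoidHom.comp
    (γ.repr.symm.toLinearMap.toAddMonoidHom.comp
      (Finsupp.mapRange.addMonoidHom (Nat.castAddMonoidHom ℤ)))

theorem centralExp_apply (m : ι →₀ ℕ) : B.centralExp γ m =
    (γ.repr.symm (Finsupp.mapRange (Nat.cast : ℕ → ℤ) Nat.cast_zero m) : G) := rfl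

theorem centralExp_injective : Function.Injective (B.centralExp γ) :=
  Subtype.val_injective.comp
    (γ.repr.symm.injective.comp (Finsupp.mapRange_injective _ Nat.cast_zero Nat.cast_injective))

theorem centralExp_single (i : ι) : B.centralExp γ (Finsupp.single i 1) = (γ i : G) := by
  simp [centralExp_apply]

/-- The scalar is needed because the bicharacter is symmetric, but perhaps not trivial, on central
exponents. -/
theorem exists_centralPoly_monomial (m : ι →₀ ℕ) : ∃ u : kˣ,
    B.centralPoly γ (MvPolynomial.monomial m 1) = (u : k) • B.basis (B.centralExp γ m) := by
  induction m using Finsupp.induction_linear with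
  | zero => exact ⟨1, by simp [B.basis_zero]⟩
  | add f g hf hg =>
    obtain ⟨u, hu⟩ := hf
    obtain ⟨v, hv⟩ := hg
    refine ⟨u * v * B.bichar (B.centralExp γ f) (B.centralExp γ g), ?_⟩
    rw [← one_mul (1 : k), ← MvPolynomial.monomial_mul, map_mul, hu, hv, smul_mul_smul_comm,
      B.mul_basis, smul_smul, map_add (B.centralExp γ), Units.val_mul, Units.val_mul]
  | single i j =>
    induction j with
    | zero => exact ⟨1, by simp [B.basis_zero]⟩
    | succ j ih =>
      obtain ⟨u, hu⟩ := ih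
      refine ⟨u * B.bichar (B.centralExp γ (Finsupp.single i j)) (γ i), ?_⟩
      rw [Finsupp.single_add, ← one_mul (1 : k), ← MvPolynomial.monomial_mul, map_mul, hu,
        ← MvPolynomial.X, centralPoly_X, smul_mul_assoc, B.mul_basis, smul_smul,
        map_add (B.centralExp γ), centralExp_single, Units.val_mul]

theorem repr_centralPoly_mem {p : MvPolynomial ι k} {a : G}
    (h : B.basis.repr (B.centralPoly γ p) a ≠ 0) : a ∈ B.centralExps := by
  classical
  induction p using MvPolynomial.induction_on'' generalizing a with
  | C c =>
    rw [← MvPolynomial.algebraMap_eq, AlgHom.commutes, Algebra.algebraMap_eq_smul_one,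
      ← B.basis_zero, map_smul, Finsupp.smul_apply, Basis.repr_self, Finsupp.single_apply] at h
    by_cases ha : 0 = a
    · exact ha ▸ zero_mem _
    · simp [ha] at h
  | monomial_add m c f hm hc hf hmon =>
    rw [map_add, map_add, Finsupp.add_apply] at h
    by_cases hfa : B.basis.repr (B.centralPoly γ f) a = 0
    · rw [hfa, add_zero] at h
      exact hmon h
    · exact hf hfa
  | mul_X f i hf =>
    rw [map_mul, centralPoly_X] at h
    obtain ⟨b, c, hb, hc, rfl⟩ := B.exists_of_repr_mul_ne_zero h
    refine add_mem (hf hb) ?_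
    have : (γ i : G) = c := by
      by_contra hne
      simp [hne] at hc
    exact this ▸ (γ i).2

theorem repr_centralPoly (m : ι →₀ ℕ) : ∃ u : kˣ, ∀ p : MvPolynomial ι k,
    B.basis.repr (B.centralPoly γ p) (B.centralExp γ m) = u * MvPolynomial.coeff m p := by
  classical
  obtain ⟨u, hu⟩ := B.exists_centralPoly_monomial γ m
  refine ⟨u, fun p => ?_⟩
  have h : (B.basis.coord (B.centralExp γ m)).comp (B.centralPoly γ).toLinearMap =
      (u : k) • MvPolynomial.lcoeff k m := by
    refine (MvPolynomial.basisMonomials ι k).ext fun m' => ?_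
    obtain ⟨u', hu'⟩ := B.exists_centralPoly_monomial γ m'
    simp only [MvPolynomial.coe_basisMonomials, LinearMap.comp_apply, AlgHom.toLinearMap_apply,
      hu', map_smul, Basis.coord_apply, Basis.repr_self, LinearMap.smul_apply,
      MvPolynomial.lcoeff_apply, MvPolynomial.coeff_monomial, Finsupp.single_apply, smul_eq_mul,
      (B.centralExp_injective γ).eq_iff]
    split_ifs with hmm
    · subst hmm
      rw [hu] at hu'
      have := congr(B.basis.repr $hu' (B.centralExp γ m'))
      simpa using this.symm
    · simp
  simpa using LinearMap.congr_fun h p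

theorem centralPoly_injective : Function.Injective (B.centralPoly γ) := by
  rw [injective_iff_map_eq_zero]
  intro p hp
  ext m
  obtain ⟨u, hu⟩ := B.repr_centralPoly γ m
  have := hu p
  rw [hp] at this
  simpa using this.symm

/-- Clearing denominators: one shift makes the coordinates of finitely many central exponents
nonnegative. -/
theorem exists_add_centralExp {F : Finset G} (hF : ∀ g ∈ F, g ∈ B.centralExps) :
    ∃ m₀, ∀ g ∈ F, ∃ m, g + B.centralExp γ m₀ = B.centralExp γ m := by
  classical
  induction F using Finset.induction_on with
  | empty => exact ⟨0, by simp⟩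
  | insert g F hg ih =>
    obtain ⟨m₀, h₀⟩ := ih fun g hg => hF g (Finset.mem_insert_of_mem hg)
    have hgm : ∃ m₁ m, g + B.centralExp γ m₁ = B.centralExp γ m := by
      let x := γ.repr ⟨g, hF g (Finset.mem_insert_self _ _)⟩
      refine ⟨x.mapRange (fun z => (-z).toNat) (by simp), x.mapRange Int.toNat (by simp), ?_⟩
      have hx : x + ((x.mapRange (fun z => (-z).toNat) (by simp)).mapRange
          (Nat.cast : ℕ → ℤ) Nat.cast_zero) =
          ((x.mapRange Int.toNat (by simp)).mapRange (Nat.cast : ℕ → ℤ) Nat.cast_zero) := by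
        ext i
        simp only [Finsupp.add_apply, Finsupp.mapRange_apply]
        omega
      have := congr((γ.repr.symm $hx : G))
      rw [map_add, Submodule.coe_add] at this
      simpa only [x, LinearEquiv.symm_apply_apply, ← centralExp_apply] using this
    obtain ⟨m₁, m, hm⟩ := hgm
    refine ⟨m₀ + m₁, fun g' hg' => ?_⟩
    rw [Finset.mem_insert] at hg'
    rcases hg' with rfl | hg'
    · exact ⟨m + m₀, by rw [map_add, map_add, ← hm]; abel⟩
    · obtain ⟨m', hm'⟩ := h₀ g' hg'
      exact ⟨m' + m₁, by rw [map_add, map_add, ← hm', add_assoc]⟩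

theorem SupportedOn.exists_eq {y : T} {d : G} (hy : B.SupportedOn y d) :
    ∃ m p, y = B.basis (d - B.centralExp γ m) * B.centralPoly γ p := by
  classical
  obtain ⟨m₀, h₀⟩ := B.exists_add_centralExp γ
    (F := (B.basis.repr y).support.image fun a => a - d) (by
      intro g hg
      obtain ⟨a, ha, rfl⟩ := Finset.mem_image.mp hg
      exact hy a (by simpa using ha))
  suffices y ∈ (LinearMap.range (B.centralPoly γ).toLinearMap).map
      (LinearMap.mulLeft k (B.basis (d - B.centralExp γ m₀))) by
    obtain ⟨_, ⟨p, rfl⟩, h⟩ := this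
    exact ⟨m₀, p, h.symm⟩
  rw [← B.basis.linearCombination_repr y]
  refine Submodule.sum_mem _ fun a ha => Submodule.smul_mem _ _ ?_
  obtain ⟨m, hm⟩ := h₀ _ (Finset.mem_image_of_mem _ ha)
  obtain ⟨u, hu⟩ := B.exists_centralPoly_monomial γ m
  have had : d - B.centralExp γ m₀ + B.centralExp γ m = a := by rw [← hm]; abel
  refine ⟨_, ⟨MvPolynomial.monomial m
    ((u * B.bichar (d - B.centralExp γ m₀) (B.centralExp γ m))⁻¹ : kˣ), rfl⟩, ?_⟩
  rw [← mul_one (Units.val _), ← smul_eq_mul, ← MvPolynomial.smul_monomial]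
  simp only [map_smul, AlgHom.toLinearMap_apply, hu, LinearMap.mulLeft_apply, B.mul_basis, had,
    smul_smul, ← Units.val_mul, inv_mul_cancel, Units.val_one, one_smul,
    mul_assoc]

/-- Divisibility descends from the torus to the polynomial ring: drop the noncentral part of the
cofactor, clear denominators by a monomial, and cancel that monomial, whose factors the prime `q`
does not divide. -/
theorem dvd_of_centralPoly_eq_mul {p q : MvPolynomial ι k} (hq : Prime q)
    (hqX : ∀ i, ¬ q ∣ MvPolynomial.X i) {t : T}
    (h : B.centralPoly γ p = B.centralPoly γ q * t) : q ∣ p := by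
  classical
  -- Multiplication by a central polynomial preserves cosets of the central lattice, so the central
  -- part of `t` alone satisfies the equation.
  let t₀ := B.basis.repr.symm ((B.basis.repr t).filter (· ∈ B.centralExps))
  have ht₀ : ∀ a, B.basis.repr t₀ a = if a ∈ B.centralExps then B.basis.repr t a else 0 := by
    intro a
    simp [t₀, Finsupp.filter_apply]
  have h₀ : B.centralPoly γ p = B.centralPoly γ q * t₀ := by
    have hsub : B.centralPoly γ p - B.centralPoly γ q * t₀ = B.centralPoly γ q * (t - t₀) := by
      rw [h, mul_sub]
    have hz : B.centralPoly γ p - B.centralPoly γ q * t₀ = 0 := by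
      refine B.basis.repr.map_eq_zero_iff.mp (Finsupp.ext fun a => ?_)
      by_contra hne
      have hne' := hne
      rw [hsub] at hne'
      obtain ⟨b, c, hb, hc, rfl⟩ := B.exists_of_repr_mul_ne_zero hne'
      have hbm := B.repr_centralPoly_mem γ hb
      have hcm : c ∉ B.centralExps := by
        intro hcm
        apply hc
        simp [ht₀, hcm]
      have hbc : b + c ∉ B.centralExps := fun hbc => hcm ((Submodule.add_mem_iff_right _ hbm).mp hbc)
      apply hne
      rw [map_sub, Finsupp.sub_apply]
      have h1 : B.basis.repr (B.centralPoly γ p) (b + c) = 0 := by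
        by_contra hp
        exact hbc (B.repr_centralPoly_mem γ hp)
      have h2 : B.basis.repr (B.centralPoly γ q * t₀) (b + c) = 0 := by
        by_contra hp
        obtain ⟨b', c', hb', hc', heq⟩ := B.exists_of_repr_mul_ne_zero hp
        apply hbc
        rw [← heq]
        refine add_mem (B.repr_centralPoly_mem γ hb') ?_
        by_contra hcon
        simp [ht₀, hcon] at hc'
      rw [h1, h2, sub_zero, Finsupp.zero_apply]
    exact sub_eq_zero.mp hz
  have hs : B.SupportedOn t₀ 0 := by
    intro a ha
    by_contra hcon
    rw [sub_zero] at hcon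
    simp [ht₀, hcon] at ha
  obtain ⟨m, p', hp'⟩ := SupportedOn.exists_eq B γ hs
  obtain ⟨u, hu⟩ := B.exists_centralPoly_monomial γ m
  obtain ⟨v, hv⟩ := B.exists_basis_mul_neg (B.centralExp γ m)
  have key : MvPolynomial.monomial m 1 * p = q * (MvPolynomial.C ((u * v : kˣ) : k) * p') := by
    apply B.centralPoly_injective γ
    rw [map_mul, h₀, hp', hu, ← mul_assoc, B.centralPoly_comm, mul_assoc, zero_sub,
      ← mul_assoc (_ • _), smul_mul_assoc, hv, Algebra.smul_def, ← map_mul, ← Units.val_mul,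
      map_mul, map_mul, ← MvPolynomial.algebraMap_eq, AlgHom.commutes]
  rcases hq.dvd_or_dvd (Dvd.intro _ key.symm) with hd | hd
  · exfalso
    rw [MvPolynomial.monomial_eq, map_one, one_mul, Finsupp.prod] at hd
    obtain ⟨i, -, hi⟩ := (Prime.dvd_finsetProd_iff hq _).mp hd
    exact hqX i (hq.dvd_of_dvd_pow hi)
  · exact hd

/-- If both factors lay outside `qT`, each could be replaced in turn by a monomial times a central
polynomial, still outside `qT`. This contradicts primality of `q` among polynomials. -/
theorem mem_range_or_mem_range (E : AddSubmonoid G)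
    (hE : ∀ a, (∀ b ∈ E, B.bichar b a = B.bichar a b) → a ∈ B.centralExps)
    {q : MvPolynomial ι k} (hq : Prime q) (hqX : ∀ i, ¬ q ∣ MvPolynomial.X i) {a b : T}
    (h : ∀ c ∈ E, a * B.basis c * b ∈ LinearMap.range (LinearMap.mulLeft k (B.centralPoly γ q))) :
    a ∈ LinearMap.range (LinearMap.mulLeft k (B.centralPoly γ q)) ∨
      b ∈ LinearMap.range (LinearMap.mulLeft k (B.centralPoly γ q)) := by
  set I := LinearMap.range (LinearMap.mulLeft k (B.centralPoly γ q)) with hI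
  have hr : ∀ x ∈ I, ∀ t, x * t ∈ I := by
    rintro _ ⟨x, rfl⟩ t
    exact ⟨x * t, by simp [mul_assoc]⟩
  have hl : ∀ x ∈ I, ∀ t, t * x ∈ I := by
    rintro _ ⟨x, rfl⟩ t
    exact ⟨t * x, by simp [← mul_assoc, B.centralPoly_comm]⟩
  have hcancel : ∀ x d, x * B.basis d ∈ I → x ∈ I := by
    intro x d hx
    obtain ⟨t, ht⟩ := B.exists_basis_mul_eq_one d
    simpa [mul_assoc, ht] using hr _ hx t
  by_contra! hcon
  obtain ⟨ha, hb⟩ := hcon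
  -- The right annihilator condition over all of `E`, rather than for one monomial, is what makes
  -- `W` stable under conjugation.
  let W : Submodule k T := ⨅ c ∈ E, I.comap (LinearMap.mulLeft k (a * B.basis c))
  have hW : ∀ y, y ∈ W ↔ ∀ c ∈ E, a * B.basis c * y ∈ I := by
    simp [W, mul_assoc]
  obtain ⟨z, hzW, hz, d, hd⟩ := B.exists_supportedOn E hE (W := W) (W' := I) (by
    intro e he y hy
    rw [hW] at hy ⊢
    intro c hc
    have := hr _ (I.smul_mem (B.bichar c e : k) (hy (c + e) (add_mem hc he))) (B.basis (-e))
    rw [← smul_mul_assoc, ← mul_smul_comm, ← B.mul_basis] at this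
    simpa only [mul_assoc] using this) ((hW b).mpr h) hb
  obtain ⟨m, p, rfl⟩ := SupportedOn.exists_eq B γ hd
  have hap : a * B.centralPoly γ p ∈ I := by
    have := (hW _).mp hzW 0 (zero_mem _)
    rw [B.basis_zero, mul_one, B.centralPoly_comm, ← mul_assoc] at this
    exact hcancel _ _ this
  have hqp : ¬ q ∣ p := by
    rintro ⟨r, rfl⟩
    apply hz
    apply hl
    exact ⟨B.centralPoly γ r, by simp⟩
  -- As the right factor is now central, the same reduction applies to `a`.
  let W₂ : Submodule k T := I.comap (LinearMap.mulRight k (B.centralPoly γ p))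
  obtain ⟨z₂, hzW₂, hz₂, d₂, hd₂⟩ := B.exists_supportedOn E hE (W := W₂) (W' := I) (by
    intro e he y hy
    change B.basis e * y * B.basis (-e) * B.centralPoly γ p ∈ I
    rw [mul_assoc _ (B.basis (-e)), B.centralPoly_comm, mul_assoc, ← mul_assoc y]
    exact hl _ (hr _ hy _) _) (y := a) hap ha
  obtain ⟨m₂, p₂, rfl⟩ := SupportedOn.exists_eq B γ hd₂
  have hqp₂ : ¬ q ∣ p₂ := by
    rintro ⟨r, rfl⟩
    apply hz₂
    apply hl
    exact ⟨B.centralPoly γ r, by simp⟩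
  have hpp : B.centralPoly γ (p₂ * p) ∈ I := by
    have : B.basis (d₂ - B.centralExp γ m₂) * B.centralPoly γ p₂ * B.centralPoly γ p ∈ I := hzW₂
    rw [mul_assoc, ← map_mul, B.centralPoly_comm] at this
    exact hcancel _ _ this
  obtain ⟨t, ht⟩ := hpp
  rcases hq.dvd_or_dvd (B.dvd_of_centralPoly_eq_mul γ hq hqX ht.symm) with h | h
  exacts [hqp₂ h, hqp h]

end Center

end BicharBasis

/-! ### Normal elements and prime ideals -/

theorem TwoSidedIdeal.mem_span_singleton_of_isNormalElem {A : Type*} [Ring A] {a : A}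
    (ha : IsNormalElem a) (x : A) : x ∈ TwoSidedIdeal.span {a} ↔ ∃ r, x = a * r := by
  constructor
  · intro hx
    have hset : ∀ y, (∃ r, y = r * a) ↔ ∃ r, y = a * r := fun y => Set.ext_iff.mp ha y
    let J : TwoSidedIdeal A := TwoSidedIdeal.mk' {x | ∃ r, x = a * r} ⟨0, by simp⟩
      (by rintro _ _ ⟨r, rfl⟩ ⟨t, rfl⟩; exact ⟨r + t, by rw [mul_add]⟩)
      (by rintro _ ⟨r, rfl⟩; exact ⟨-r, by rw [mul_neg]⟩)
      (by
        rintro t y hy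
        obtain ⟨r, rfl⟩ := (hset y).mpr hy
        exact (hset _).mp ⟨t * r, by rw [mul_assoc]⟩)
      (by rintro _ t ⟨r, rfl⟩; exact ⟨r * t, by rw [mul_assoc]⟩)
    have hJ : TwoSidedIdeal.span {a} ≤ J := by
      rw [TwoSidedIdeal.span_le, Set.singleton_subset_iff]
      exact (TwoSidedIdeal.mem_mk' ..).mpr ⟨1, by simp⟩
    exact (TwoSidedIdeal.mem_mk' {x | ∃ r, x = a * r} _ _ _ _ _ x).mp (hJ hx)
  · rintro ⟨r, rfl⟩
    exact TwoSidedIdeal.mul_mem_right _ _ _ (TwoSidedIdeal.subset_span rfl)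

namespace TwoSidedIdeal.IsPrimeIdeal

variable {A : Type*} [Ring A] {P : TwoSidedIdeal A} {s t : A}

theorem one_notMem (hP : P.IsPrimeIdeal) : (1 : A) ∉ P := by
  intro h
  refine hP.1 (top_le_iff.mp fun x _ => ?_)
  simpa using P.mul_mem_left x _ h

theorem mem_or_mem_of_normal_mul (hP : P.IsPrimeIdeal) (hs : IsNormalElem s) (h : s * t ∈ P) :
    s ∈ P ∨ t ∈ P := by
  refine hP.2 _ _ fun r => ?_
  obtain ⟨r', hr'⟩ := (Set.ext_iff.mp hs (s * r)).mpr ⟨r, rfl⟩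
  rw [hr', mul_assoc]
  exact P.mul_mem_left _ _ h

theorem mem_or_mem_of_mul_normal (hP : P.IsPrimeIdeal) (hs : IsNormalElem s) (h : t * s ∈ P) :
    t ∈ P ∨ s ∈ P := by
  refine hP.2 _ _ fun r => ?_
  obtain ⟨r', hr'⟩ := (Set.ext_iff.mp hs (r * s)).mp ⟨r, rfl⟩
  rw [mul_assoc, hr', ← mul_assoc]
  exact P.mul_mem_right _ _ h

end TwoSidedIdeal.IsPrimeIdeal

theorem TwoSidedIdeal.smul_mem_of_mem {k A : Type*} [Field k] [Ring A] [Algebra k A]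
    (P : TwoSidedIdeal A) (c : k) {x : A} (hx : x ∈ P) : c • x ∈ P := by
  rw [Algebra.smul_def]
  exact P.mul_mem_left _ _ hx

namespace BicharBasis

theorem isNormalElem_of_comm {k M A : Type*} [Field k] [AddCommMonoid M] [Ring A] [Algebra k A]
    (B : BicharBasis k M A) {s : A}
    (h : ∀ c, ∃ u : kˣ, B.basis c * s = (u : k) • (s * B.basis c)) : IsNormalElem s := by
  choose u hu using h
  have key : ∀ r, r ∈ (LinearMap.range (LinearMap.mulRight k s)).comap (LinearMap.mulLeft k s) ∧
      r ∈ (LinearMap.range (LinearMap.mulLeft k s)).comap (LinearMap.mulRight k s) := by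
    intro r
    rw [← B.basis.linearCombination_repr r]
    refine ⟨Submodule.sum_mem _ fun a _ => Submodule.smul_mem _ _ ⟨((u a)⁻¹ : kˣ) • B.basis a, ?_⟩,
      Submodule.sum_mem _ fun a _ => Submodule.smul_mem _ _ ⟨(u a) • B.basis a, ?_⟩⟩
    · simp [hu, Units.smul_def]
    · simp [hu, Units.smul_def]
  ext x
  constructor
  · rintro ⟨r, rfl⟩
    obtain ⟨r', hr'⟩ := (key r).2
    exact ⟨r', hr'.symm⟩
  · rintro ⟨r, rfl⟩
    obtain ⟨r', hr'⟩ := (key r).1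
    exact ⟨r', hr'.symm⟩

/-! ### The positive part of a quantum torus -/

variable {k T S : Type*} [Field k] {n : ℕ} [Ring T] [Algebra k T] [Ring S] [Algebra k S]
  (B : BicharBasis k (Fin n → ℤ) T) {ι : S →ₐ[k] T}

theorem mul_ne_zero_of_ne_zero (B : BicharBasis k (Fin n → ℤ) T) {f g : T} (hf : f ≠ 0) (hg : g ≠ 0) : f * g ≠ 0 := by
  let ψ : (Fin n → ℤ) →+ Lex (Fin n → ℤ) := ⟨⟨toLex, rfl⟩, fun _ _ => rfl⟩
  obtain ⟨a, ha, ha'⟩ := B.exists_min_image_repr hf ψ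
  obtain ⟨b, hb, hb'⟩ := B.exists_min_image_repr hg ψ
  have := B.repr_mul_ne_zero_of_min ψ toLex.injective ha ha' hb hb'
  rintro h
  simp [h] at this

/-- The minimal `i`-th exponent is additive on products. Refining the `i`-th coordinate by the
lexicographic order makes the minimal terms unique, so their product survives. -/
theorem le_add_of_repr_mul {f g : T} {i : Fin n} {m : ℤ}
    (h : ∀ a, B.basis.repr (f * g) a ≠ 0 → m ≤ a i) {a b : Fin n → ℤ}
    (ha : B.basis.repr f a ≠ 0) (hb : B.basis.repr g b ≠ 0) : m ≤ a i + b i := by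
  let ψ : (Fin n → ℤ) →+ ℤ ×ₗ Lex (Fin n → ℤ) :=
    ⟨⟨fun a => toLex (a i, toLex a), rfl⟩, fun _ _ => rfl⟩
  have hψ : Function.Injective ψ := fun a b hab =>
    toLex.injective (congr_arg Prod.snd (toLex.injective hab))
  have hle : ∀ a b, ψ a ≤ ψ b → a i ≤ b i := by
    intro a b hab
    rcases Prod.Lex.toLex_le_toLex.mp hab with h | h
    exacts [h.le, h.1.le]
  obtain ⟨a₀, ha₀, ha'⟩ := B.exists_min_image_repr (f := f) (by rintro rfl; simp at ha) ψ
  obtain ⟨b₀, hb₀, hb'⟩ := B.exists_min_image_repr (f := g) (by rintro rfl; simp at hb) ψ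
  have h1 := h _ (B.repr_mul_ne_zero_of_min ψ hψ ha₀ ha' hb₀ hb')
  exact h1.trans (add_le_add (hle _ _ (ha' a ha)) (hle _ _ (hb' b hb)))

/-- `ι` identifies `S` with the span of the basis elements with nonnegative exponents. -/
structure IsPositivePart (ι : S →ₐ[k] T) : Prop where
  injective : Function.Injective ι
  mem_range : ∀ t, t ∈ Set.range ι ↔ ∀ a, B.basis.repr t a ≠ 0 → 0 ≤ a

/-- The inclusion of exponents. -/
def natExp (n : ℕ) : (Fin n → ℕ) →+ (Fin n → ℤ) where
  toFun c i := c i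
  map_zero' := rfl
  map_add' _ _ := by ext; simp

theorem natExp_injective : Function.Injective (natExp n) := fun a b h => by
  ext i
  exact Nat.cast_injective (R := ℤ) (congr_fun h i)

theorem exists_natExp {a : Fin n → ℤ} (ha : 0 ≤ a) : ∃ c, natExp n c = a :=
  ⟨fun i => (a i).toNat, funext fun i => Int.toNat_of_nonneg (ha i)⟩

theorem natExp_nonneg (c : Fin n → ℕ) : 0 ≤ natExp n c := fun i => Int.natCast_nonneg (c i)

theorem exists_basis_mul_mem (t : T) : ∃ c₀, 0 ≤ c₀ ∧ ∀ c, c₀ ≤ c → ∀ a,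
    B.basis.repr (B.basis c * t) a ≠ 0 → 0 ≤ a := by
  refine ⟨fun i => ∑ a ∈ (B.basis.repr t).support, |a i|,
    fun i => Finset.sum_nonneg fun _ _ => abs_nonneg _, fun c hc d hd i => ?_⟩
  obtain ⟨a, ha, rfl⟩ := B.exists_of_repr_basis_mul_ne_zero hd
  have h1 : |a i| ≤ ∑ a ∈ (B.basis.repr t).support, |a i| :=
    Finset.single_le_sum (f := fun a : Fin n → ℤ => |a i|) (fun _ _ => abs_nonneg _)
      (by simpa using ha)
  have h2 := hc i
  have h3 := neg_abs_le (a i)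
  simp only [Pi.zero_apply, Pi.add_apply] at *
  linarith

/-- Every integer vector is a difference of two nonnegative ones. -/
theorem mem_centralExps_of_nonneg {a : Fin n → ℤ}
    (h : ∀ b ∈ AddSubmonoid.nonneg (Fin n → ℤ), B.bichar b a = B.bichar a b) :
    a ∈ B.centralExps := by
  intro b
  have hb : b = b ⊔ 0 + -((-b) ⊔ 0) := by
    ext i
    simp only [Pi.add_apply, Pi.sup_apply, Pi.neg_apply, Pi.zero_apply]
    omega
  rw [hb, B.bichar_add_left, B.bichar_add_right, B.bichar_neg_left, B.bichar_neg_right,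
    h (b ⊔ 0) (AddSubmonoid.mem_nonneg.mpr le_sup_right),
    h (-b ⊔ 0) (AddSubmonoid.mem_nonneg.mpr le_sup_right)]

namespace IsPositivePart

variable {B} (h : B.IsPositivePart ι)

theorem exists_basis (h : B.IsPositivePart ι) (c : Fin n → ℕ) : ∃ s, ι s = B.basis (natExp n c) := by
  refine (h.mem_range _).mpr fun a ha => ?_
  have : natExp n c = a := by
    by_contra hne
    simp [hne] at ha
  exact this ▸ natExp_nonneg c

theorem repr_nonneg (h : B.IsPositivePart ι) (s : S) {a : Fin n → ℤ} (ha : B.basis.repr (ι s) a ≠ 0) : 0 ≤ a :=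
  (h.mem_range _).mp ⟨s, rfl⟩ a ha

/-- The basis of `S` of the monomials with nonnegative exponents. -/
noncomputable def bicharBasis : BicharBasis k (Fin n → ℕ) S where
  basis := Basis.mk (v := fun c => (h.exists_basis c).choose)
    (by
      refine LinearIndependent.of_comp ι.toLinearMap ?_
      convert B.basis.linearIndependent.comp _ natExp_injective using 1
      ext c
      exact (h.exists_basis c).choose_spec)
    (by
      rintro s -
      have hs : ι s ∈ (Submodule.span k (Set.range fun c => (h.exists_basis c).choose)).map
          ι.toLinearMap := by
        rw [← B.basis.linearCombination_repr (ι s)]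
        refine Submodule.sum_mem _ fun a ha => Submodule.smul_mem _ _ ?_
        obtain ⟨c, rfl⟩ := exists_natExp (h.repr_nonneg s (by simpa using ha))
        exact ⟨_, Submodule.subset_span ⟨c, rfl⟩, (h.exists_basis c).choose_spec⟩
      obtain ⟨s', hs', heq⟩ := hs
      exact h.injective heq ▸ hs')
  bichar a b := B.bichar (natExp n a) (natExp n b)
  bichar_add_left a b c := by rw [map_add, B.bichar_add_left]
  bichar_add_right a b c := by rw [map_add, B.bichar_add_right]
  mul_basis a b := by
    apply h.injective
    simp only [Basis.mk_apply]
    rw [map_mul, map_smul, (h.exists_basis a).choose_spec, (h.exists_basis b).choose_spec,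
      (h.exists_basis (a + b)).choose_spec, B.mul_basis,
      map_add (natExp n)]

theorem map_basis (c : Fin n → ℕ) : ι (h.bicharBasis.basis c) = B.basis (natExp n c) := by
  simp only [bicharBasis, Basis.mk_apply]
  exact (h.exists_basis c).choose_spec

theorem isPrimeIdeal_bot (h : B.IsPositivePart ι) : (⊥ : TwoSidedIdeal S).IsPrimeIdeal := by
  have h1 : (1 : S) ≠ 0 := by
    rw [← h.bicharBasis.basis_zero]
    exact h.bicharBasis.basis.ne_zero 0
  refine ⟨fun hbot => h1 ?_, fun a b hab => ?_⟩
  · rw [← TwoSidedIdeal.mem_bot, hbot]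
    trivial
  · simp only [TwoSidedIdeal.mem_bot] at hab ⊢
    by_contra! hcon
    refine B.mul_ne_zero_of_ne_zero (f := ι a) (g := ι b) ?_ ?_ ?_
    · exact (map_ne_zero_iff ι h.injective).mpr hcon.1
    · exact (map_ne_zero_iff ι h.injective).mpr hcon.2
    · rw [← map_mul, ← mul_one a, hab 1, map_zero]

theorem isNormalElem_basis (c : Fin n → ℕ) : IsNormalElem (h.bicharBasis.basis c) :=
  h.bicharBasis.isNormalElem_of_comm fun b => ⟨_, h.bicharBasis.basis_mul_comm b c⟩

theorem mem_span_basis_single (i : Fin n) (y : S) :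
    y ∈ TwoSidedIdeal.span {h.bicharBasis.basis (Pi.single i 1)} ↔
      ∀ a, B.basis.repr (ι y) a ≠ 0 → 1 ≤ a i := by
  rw [TwoSidedIdeal.mem_span_singleton_of_isNormalElem (h.isNormalElem_basis _)]
  constructor
  · rintro ⟨r, rfl⟩ a ha
    rw [map_mul, h.map_basis] at ha
    obtain ⟨b, hb, rfl⟩ := B.exists_of_repr_basis_mul_ne_zero ha
    have := h.repr_nonneg r hb i
    simpa [natExp] using this
  · intro hy
    have hmem : B.basis (-natExp n (Pi.single i 1)) * ι y ∈ Set.range ι := by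
      rw [h.mem_range]
      intro a ha j
      obtain ⟨b, hb, rfl⟩ := B.exists_of_repr_basis_mul_ne_zero ha
      have h1 := hy b hb
      have h2 := h.repr_nonneg y hb j
      by_cases hij : j = i
      · subst hij
        simpa [natExp] using h1
      · simpa [natExp, hij] using h2
    obtain ⟨r, hr⟩ := hmem
    obtain ⟨v, hv⟩ := B.exists_basis_mul_neg (natExp n (Pi.single i 1))
    refine ⟨((v⁻¹ : kˣ) : k) • r, h.injective ?_⟩
    rw [map_mul, map_smul, h.map_basis, hr, mul_smul_comm, ← mul_assoc, hv, ← Algebra.smul_def,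
      smul_smul, ← Units.val_mul, inv_mul_cancel, Units.val_one, one_smul]

/-! ### Principal primes below a nonzero prime -/

theorem exists_principal_prime_of_basis_mem {P : TwoSidedIdeal S} (hP : P.IsPrimeIdeal)
    {i : Fin n} (hi : h.bicharBasis.basis (Pi.single i 1) ∈ P) :
    ∃ Q : TwoSidedIdeal S, Q.IsPrimeIdeal ∧ Q ≠ ⊥ ∧ Q.IsNormalPrincipal ∧ Q ≤ P := by
  set x := h.bicharBasis.basis (Pi.single i 1)
  have hle : TwoSidedIdeal.span {x} ≤ P := by simpa [TwoSidedIdeal.span_le] using hi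
  refine ⟨TwoSidedIdeal.span {x}, ⟨?_, fun a b hab => ?_⟩, ?_,
    ⟨x, h.isNormalElem_basis _, rfl⟩, hle⟩
  · intro htop
    exact hP.1 (top_le_iff.mp (htop ▸ hle))
  · simp only [x, mem_span_basis_single] at hab ⊢
    by_contra! hcon
    obtain ⟨⟨c, hc, hc'⟩, d, hd, hd'⟩ := hcon
    have h1 := hab 1
    rw [mul_one, map_mul] at h1
    have := B.le_add_of_repr_mul h1 hc hd
    linarith
  · intro hbot
    have hx : x ∈ (⊥ : TwoSidedIdeal S) := hbot ▸ TwoSidedIdeal.subset_span rfl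
    exact h.bicharBasis.basis.ne_zero _ ((TwoSidedIdeal.mem_bot _).mp hx)

theorem basis_notMem {P : TwoSidedIdeal S} (hP : P.IsPrimeIdeal)
    (hX : ∀ i, h.bicharBasis.basis (Pi.single i 1) ∉ P) (c : Fin n → ℕ) :
    h.bicharBasis.basis c ∉ P := by
  induction hN : ∑ i, c i generalizing c with
  | zero =>
    have : c = 0 := by
      ext i
      simpa using (Finset.sum_eq_zero_iff.mp hN) i
    rw [this, basis_zero]
    exact hP.one_notMem
  | succ N ih =>
    intro hc
    obtain ⟨i, -, hi⟩ : ∃ i ∈ Finset.univ, c i ≠ 0 :=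
      Finset.exists_ne_zero_of_sum_ne_zero (by rw [hN]; simp)
    have hle : Pi.single i 1 ≤ c := by
      intro j
      by_cases hij : j = i
      · subst hij
        simpa using Nat.one_le_iff_ne_zero.mpr hi
      · simp [hij]
    obtain ⟨d, rfl⟩ := exists_add_of_le hle
    have hmul : h.bicharBasis.basis (Pi.single i 1) * h.bicharBasis.basis d ∈ P := by
      rw [h.bicharBasis.mul_basis]
      exact P.smul_mem_of_mem _ hc
    rcases hP.mem_or_mem_of_normal_mul (h.isNormalElem_basis _) hmul with h1 | h1
    · exact hX i h1
    · refine ih d ?_ h1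
      simp only [Pi.add_apply, Finset.sum_add_distrib, Finset.sum_pi_single', Finset.mem_univ,
        if_true] at hN
      omega

theorem false_of_map_eq_smul_basis {P : TwoSidedIdeal S} (hP : P.IsPrimeIdeal)
    (hX : ∀ i, h.bicharBasis.basis (Pi.single i 1) ∉ P) {f : S} (hf : f ∈ P) {u : k} (hu : u ≠ 0)
    {e : Fin n → ℤ} (hfe : ι f = u • B.basis e) : False := by
  obtain ⟨c, rfl⟩ := exists_natExp (h.repr_nonneg f (a := e) (by simp [hfe, hu]))
  refine h.basis_notMem hP hX c ?_
  have : h.bicharBasis.basis c = u⁻¹ • f := by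
    apply h.injective
    rw [h.map_basis, map_smul, hfe, inv_smul_smul₀ hu]
  rw [this]
  exact P.smul_mem_of_mem _ hf

variable {κ : Type*} (γ : Basis κ ℤ B.centralExps)

theorem isNormalElem_of_map_eq (h : B.IsPositivePart ι) {s : S} {e : Fin n → ℤ} {p : MvPolynomial κ k}
    (hs : ι s = B.basis e * B.centralPoly γ p) : IsNormalElem s := by
  refine h.bicharBasis.isNormalElem_of_comm fun c =>
    ⟨B.bichar (natExp n c) e / B.bichar e (natExp n c), h.injective ?_⟩
  rw [map_mul, map_smul, map_mul, hs, h.map_basis, ← mul_assoc, B.basis_mul_comm, smul_mul_assoc,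
    mul_assoc, B.centralPoly_comm, ← mul_assoc]

/-- For `y ∈ P`, the conjugate `y'` of `y` by `x^c` satisfies `y' x^c ∈ k x^c y ⊆ P`. Since `x^c` is
normal and not in `P`, also `y' ∈ P`; the separation argument then applies to `P`. -/
theorem exists_mem_map_eq {P : TwoSidedIdeal S} (hP : P.IsPrimeIdeal) (hP0 : P ≠ ⊥)
    (hX : ∀ i, h.bicharBasis.basis (Pi.single i 1) ∉ P) :
    ∃ p, p ≠ 0 ∧ ∃ e, ∃ f ∈ P, ι f = B.basis e * B.centralPoly γ p := by
  obtain ⟨f, hf, hf0⟩ : ∃ f ∈ P, f ≠ 0 := by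
    by_contra! hcon
    exact hP0 (le_bot_iff.mp fun x hx => (TwoSidedIdeal.mem_bot _).mpr (hcon x hx))
  let P' : Submodule k S :=
    { carrier := P
      add_mem' := P.add_mem
      zero_mem' := P.zero_mem
      smul_mem' := fun c x hx => P.smul_mem_of_mem c hx }
  obtain ⟨z, ⟨g, hg, rfl⟩, hz, d, hd⟩ := B.exists_supportedOn (AddSubmonoid.nonneg _)
    (fun a => B.mem_centralExps_of_nonneg) (W := P'.map ι.toLinearMap) (W' := ⊥) (by
      rintro b hb _ ⟨y, hy, rfl⟩
      obtain ⟨c, rfl⟩ := exists_natExp hb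
      obtain ⟨y', hy'⟩ : B.basis (natExp n c) * ι y * B.basis (-natExp n c) ∈ Set.range ι := by
        rw [h.mem_range]
        intro a ha
        rw [B.repr_conj] at ha
        exact h.repr_nonneg y (right_ne_zero_of_mul ha)
      refine ⟨y', ?_, hy'⟩
      obtain ⟨v, hv⟩ := B.exists_basis_mul_neg (-natExp n c)
      rw [neg_neg] at hv
      have hmul : y' * h.bicharBasis.basis c = (v : k) • (h.bicharBasis.basis c * y) := by
        apply h.injective
        rw [map_mul, hy', h.map_basis, map_smul, map_mul, h.map_basis, mul_assoc, hv,
          Algebra.smul_def, Algebra.commutes]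
      have hmem : y' * h.bicharBasis.basis c ∈ P := by
        rw [hmul]
        exact P.smul_mem_of_mem _ (P.mul_mem_left _ _ hy)
      exact (hP.mem_or_mem_of_mul_normal (h.isNormalElem_basis c) hmem).resolve_right
        (h.basis_notMem hP hX c))
    (y := ι f) ⟨f, hf, rfl⟩ (by
      rw [Submodule.mem_bot]
      exact (map_ne_zero_iff ι h.injective).mpr hf0)
  obtain ⟨m, p, hp⟩ := SupportedOn.exists_eq B γ hd
  refine ⟨p, ?_, _, g, hg, hp⟩
  rintro rfl
  exact hz (by rw [hp]; simp)

/-- A factorization of `p` is lifted to `S` by multiplying each factor by a high monomial. The lifts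
are normal, so `P` contains one of them; a constant `p` would put a monomial in `P`. -/
theorem exists_prime_mem_map_eq {P : TwoSidedIdeal S} (hP : P.IsPrimeIdeal)
    (hX : ∀ i, h.bicharBasis.basis (Pi.single i 1) ∉ P) (p : MvPolynomial κ k) (hp : p ≠ 0)
    (e : Fin n → ℤ) (f : S) (hf : f ∈ P) (hfp : ι f = B.basis e * B.centralPoly γ p) :
    ∃ q, Prime q ∧ ∃ e, ∃ f ∈ P, ι f = B.basis e * B.centralPoly γ q := by
  induction p using UniqueFactorizationMonoid.induction_on_prime generalizing e f with
  | h₁ => exact absurd rfl hp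
  | h₂ p hu =>
    obtain ⟨c, hc, rfl⟩ := MvPolynomial.isUnit_iff_eq_C_of_isReduced.mp hu
    refine (h.false_of_map_eq_smul_basis hP hX hf hc.ne_zero (e := e) ?_).elim
    rw [hfp, ← MvPolynomial.algebraMap_eq, AlgHom.commutes, Algebra.smul_def, Algebra.commutes]
  | h₃ a q ha hq ih =>
    obtain ⟨c, hc0, hc⟩ := B.exists_basis_mul_mem (B.centralPoly γ q)
    obtain ⟨d, hd0, hd⟩ := B.exists_basis_mul_mem (B.centralPoly γ a)
    obtain ⟨s, hs⟩ := (h.mem_range _).mpr (hc c le_rfl)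
    -- The extra `|e|` makes `c + (d + |e|) - e` nonnegative, so that `s * t` is a left multiple of
    -- `f` inside `S`.
    obtain ⟨t, ht⟩ := (h.mem_range _).mpr (hd (d + |e|) (le_add_of_nonneg_right (abs_nonneg e)))
    obtain ⟨b, hb⟩ := exists_natExp (a := c + (d + |e|) - e) (by
      rw [add_sub_assoc, add_sub_assoc]
      exact add_nonneg hc0 (add_nonneg hd0 (sub_nonneg.mpr (le_abs_self e))))
    have hst : s * t = ((B.bichar c (d + |e|) / B.bichar (natExp n b) e : kˣ) : k) •
        (h.bicharBasis.basis b * f) := by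
      apply h.injective
      rw [map_mul, map_smul, map_mul, hs, ht, hfp, h.map_basis, mul_assoc,
        ← mul_assoc (B.centralPoly γ q), ← B.centralPoly_comm, ← mul_assoc, ← mul_assoc,
        ← mul_assoc, B.mul_basis, B.mul_basis, map_mul, hb, sub_add_cancel, smul_mul_assoc,
        smul_mul_assoc, smul_mul_assoc, smul_smul, ← Units.val_mul, div_mul_cancel, mul_assoc]
    have hmem : s * t ∈ P := by
      rw [hst]
      exact P.smul_mem_of_mem _ (P.mul_mem_left _ _ hf)
    rcases hP.mem_or_mem_of_normal_mul (h.isNormalElem_of_map_eq γ hs) hmem with h1 | h1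
    · exact ⟨q, hq, c, s, h1, hs⟩
    · exact ih ha _ t h1 ht

theorem exists_normalized {P : TwoSidedIdeal S} (hP : P.IsPrimeIdeal)
    (hX : ∀ i, h.bicharBasis.basis (Pi.single i 1) ∉ P) {q : MvPolynomial κ k} (hq : q ≠ 0)
    {e : Fin n → ℤ} {f : S} (hf : f ∈ P) (hfq : ι f = B.basis e * B.centralPoly γ q) :
    ∃ c, ∃ s ∈ P, ι s = B.basis c * B.centralPoly γ q ∧
      ∀ i, ∃ a, B.basis.repr (ι s) a ≠ 0 ∧ a i = 0 := by
  have hq0 : B.centralPoly γ q ≠ 0 := (map_ne_zero_iff _ (B.centralPoly_injective γ)).mpr hq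
  choose a ha ha' using fun i : Fin n => B.exists_min_image_repr hq0 (fun b => b i)
  -- The shift that makes the least exponent in every coordinate exactly zero.
  let c : Fin n → ℤ := fun i => -(a i i)
  obtain ⟨s, hs⟩ : B.basis c * B.centralPoly γ q ∈ Set.range ι := by
    rw [h.mem_range]
    intro d hd i
    obtain ⟨b, hb, rfl⟩ := B.exists_of_repr_basis_mul_ne_zero hd
    have := ha' i b hb
    simp only [c, Pi.add_apply, Pi.zero_apply]
    linarith
  obtain ⟨b, hb⟩ := exists_natExp (a := e - c) (by
    intro i
    have := h.repr_nonneg f (a := e + a i) (by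
      rw [hfq, B.repr_basis_mul]
      exact mul_ne_zero (Units.ne_zero _) (ha i)) i
    simpa [c] using this)
  have hbs : h.bicharBasis.basis b * s ∈ P := by
    have : h.bicharBasis.basis b * s = (B.bichar (natExp n b) c : k) • f := by
      apply h.injective
      rw [map_mul, map_smul, h.map_basis, hs, hfq, ← mul_assoc, B.mul_basis, hb, sub_add_cancel,
        smul_mul_assoc]
    rw [this]
    exact P.smul_mem_of_mem _ hf
  refine ⟨c, s, (hP.mem_or_mem_of_normal_mul (h.isNormalElem_basis b) hbs).resolve_left
    (h.basis_notMem hP hX b), hs, fun i => ⟨c + a i, ?_, ?_⟩⟩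
  · rw [hs, B.repr_basis_mul]
    exact mul_ne_zero (Units.ne_zero _) (ha i)
  · simp [c]

/-- If `ι y = ι s * t` with `t` in the torus, additivity of minimal exponents shows that `t` has
none negative, because those of `s` are zero; hence `t` comes from `S`. -/
theorem mem_span_iff_of_normalized (h : B.IsPositivePart ι) {s : S} {c : Fin n → ℤ} {q : MvPolynomial κ k}
    (hs : ι s = B.basis c * B.centralPoly γ q)
    (hs' : ∀ i, ∃ a, B.basis.repr (ι s) a ≠ 0 ∧ a i = 0) (y : S) :
    y ∈ TwoSidedIdeal.span {s} ↔
      ι y ∈ LinearMap.range (LinearMap.mulLeft k (B.centralPoly γ q)) := by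
  rw [TwoSidedIdeal.mem_span_singleton_of_isNormalElem (h.isNormalElem_of_map_eq γ hs)]
  constructor
  · rintro ⟨r, rfl⟩
    refine ⟨B.basis c * ι r, ?_⟩
    rw [LinearMap.mulLeft_apply, map_mul, hs, ← mul_assoc, B.centralPoly_comm]
  · rintro ⟨t, ht⟩
    rw [LinearMap.mulLeft_apply] at ht
    obtain ⟨t', ht'⟩ := B.exists_basis_mul_eq_one c
    have hy : ι y = ι s * (t' * t) := by
      rw [hs, B.centralPoly_comm, mul_assoc, ← mul_assoc _ t', ht', one_mul, ht]
    obtain ⟨r, hr⟩ : t' * t ∈ Set.range ι := by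
      rw [h.mem_range]
      intro b hb i
      obtain ⟨a, ha, hai⟩ := hs' i
      have := B.le_add_of_repr_mul (f := ι s) (g := t' * t) (i := i) (m := 0)
        (fun d hd => h.repr_nonneg y (hy ▸ hd) i) ha hb
      simpa [hai] using this
    exact ⟨r, h.injective (by rw [hy, map_mul, hr])⟩

theorem exists_principal_prime_of_basis_notMem {P : TwoSidedIdeal S} (hP : P.IsPrimeIdeal)
    (hP0 : P ≠ ⊥) (hX : ∀ i, h.bicharBasis.basis (Pi.single i 1) ∉ P) :
    ∃ Q : TwoSidedIdeal S, Q.IsPrimeIdeal ∧ Q ≠ ⊥ ∧ Q.IsNormalPrincipal ∧ Q ≤ P := by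
  let γ := Module.finBasis ℤ B.centralExps
  obtain ⟨p, hp, e₀, f₀, hf₀, hfp⟩ := h.exists_mem_map_eq γ hP hP0 hX
  obtain ⟨q, hq, e, f, hf, hfq⟩ := h.exists_prime_mem_map_eq γ hP hX p hp e₀ f₀ hf₀ hfp
  obtain ⟨c, s, hsP, hs, hs'⟩ := h.exists_normalized γ hP hX hq.ne_zero hf hfq
  -- Otherwise `q` would be associated to a variable, and `P` would contain a monomial.
  have hqX : ∀ i, ¬ q ∣ MvPolynomial.X i := by
    rintro i ⟨r, hr⟩
    have hir : Irreducible (MvPolynomial.X i : MvPolynomial _ k) :=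
      MvPolynomial.X_prime.irreducible
    obtain ⟨v, -, rfl⟩ := MvPolynomial.isUnit_iff_eq_C_of_isReduced.mp
      ((hir.isUnit_or_isUnit hr).resolve_left hq.not_isUnit)
    refine h.false_of_map_eq_smul_basis hP hX (P.smul_mem_of_mem v hsP)
      (u := B.bichar c (γ i)) (Units.ne_zero _) (e := c + γ i) ?_
    rw [← B.mul_basis, ← B.centralPoly_X γ, hr, map_mul, ← MvPolynomial.algebraMap_eq,
      AlgHom.commutes, map_smul, hs, ← mul_assoc, ← Algebra.commutes, Algebra.smul_def]
  have hle : TwoSidedIdeal.span {s} ≤ P := by simpa [TwoSidedIdeal.span_le] using hsP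
  refine ⟨TwoSidedIdeal.span {s}, ⟨?_, fun a b hab => ?_⟩, ?_,
    ⟨s, h.isNormalElem_of_map_eq γ hs, rfl⟩, hle⟩
  · intro htop
    exact hP.1 (top_le_iff.mp (htop ▸ hle))
  · simp only [h.mem_span_iff_of_normalized γ hs hs'] at hab ⊢
    refine B.mem_range_or_mem_range γ (AddSubmonoid.nonneg _)
      (fun a => B.mem_centralExps_of_nonneg) hq hqX fun d hd => ?_
    obtain ⟨d, rfl⟩ := exists_natExp hd
    have := hab (h.bicharBasis.basis d)
    rwa [map_mul, map_mul, h.map_basis] at this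
  · intro hbot
    have hs0 : s ∈ (⊥ : TwoSidedIdeal S) := hbot ▸ TwoSidedIdeal.subset_span rfl
    rw [TwoSidedIdeal.mem_bot] at hs0
    rw [hs0, map_zero] at hs
    exact B.mul_ne_zero_of_ne_zero (B.basis.ne_zero c)
      ((map_ne_zero_iff _ (B.centralPoly_injective γ)).mpr hq.ne_zero) hs.symm

theorem isNoetherianUFR (h : B.IsPositivePart ι) : IsNoetherianUFR S where
  left_noetherian := h.bicharBasis.isNoetherianRing
  right_noetherian := h.bicharBasis.op.isNoetherianRing
  prime_ring := h.isPrimeIdeal_bot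
  exists_principal_prime P hP hP0 := by
    by_cases hX : ∃ i, h.bicharBasis.basis (Pi.single i 1) ∈ P
    · obtain ⟨i, hi⟩ := hX
      exact h.exists_principal_prime_of_basis_mem hP hi
    · push Not at hX
      exact h.exists_principal_prime_of_basis_notMem hP hP0 hX

end IsPositivePart

end BicharBasis

/-! ### Existence of the twisted group algebra, as shift operators -/

section TwistedTorus

variable (k : Type*) [Field k] {G : Type*} [AddCommGroup G] (β : G → G → kˣ)

/-- The operator `e_b ↦ β(a, b) e_{a + b}` on the free module on `G`. -/
noncomputable def twistedShift (a : G) : Module.End k (G →₀ k) :=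
  Finsupp.lsum k fun b => (β a b : k) • Finsupp.lsingle (a + b)

theorem twistedShift_single (a b : G) (c : k) :
    twistedShift k β a (Finsupp.single b c) = (β a b : k) • Finsupp.single (a + b) c := by
  simp [twistedShift]

theorem twistedShift_mul (hl : ∀ a b c, β (a + b) c = β a c * β b c)
    (hr : ∀ a b c, β a (b + c) = β a b * β a c) (a b : G) :
    twistedShift k β a * twistedShift k β b = (β a b : k) • twistedShift k β (a + b) := by
  refine Finsupp.lhom_ext fun c x => ?_
  simp only [Module.End.mul_apply, LinearMap.smul_apply, twistedShift_single, map_smul, smul_smul,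
    hl, hr, Units.val_mul, add_assoc]
  ring_nf

theorem twistedShift_zero (hl : ∀ a b c, β (a + b) c = β a c * β b c) : twistedShift k β 0 = 1 := by
  refine Finsupp.lhom_ext fun c x => ?_
  have h : β 0 c = 1 := by
    have h := hl 0 0 c
    rw [add_zero] at h
    exact mul_eq_left.mp h.symm
  simp [twistedShift_single, h]

/-- Applied to the basis vector at `0`, the shifts give the distinct basis vectors of the free
module. -/
theorem linearIndependent_twistedShift (hr : ∀ a b c, β a (b + c) = β a b * β a c) :
    LinearIndependent k (twistedShift k β) := by
  refine LinearIndependent.of_comp (LinearMap.applyₗ (Finsupp.single 0 1)) ?_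
  convert (Finsupp.basisSingleOne (R := k) (ι := G)).linearIndependent using 1
  ext1 a
  have h : β a 0 = 1 := by
    have h := hr a 0 0
    rw [add_zero] at h
    exact mul_eq_left.mp h.symm
  simp [twistedShift_single, h]

variable (hl : ∀ a b c, β (a + b) c = β a c * β b c) (hr : ∀ a b c, β a (b + c) = β a b * β a c)

/-- The twisted group algebra of a bicharacter. -/
noncomputable def twistedAlgebra : Subalgebra k (Module.End k (G →₀ k)) :=
  (Submodule.span k (Set.range (twistedShift k β))).toSubalgebra
    (Submodule.subset_span ⟨0, twistedShift_zero k β hl⟩) (by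
      intro x y hx hy
      have := Submodule.mul_mem_mul hx hy
      rw [Submodule.span_mul_span] at this
      refine Submodule.span_le.mpr ?_ this
      rintro _ ⟨_, ⟨a, rfl⟩, _, ⟨b, rfl⟩, rfl⟩
      simp only [twistedShift_mul k β hl hr]
      exact Submodule.smul_mem _ _ (Submodule.subset_span ⟨_, rfl⟩))

noncomputable instance : Ring (twistedAlgebra k β hl hr) :=
  Subalgebra.toRing (R := k) (A := Module.End k (G →₀ k)) _

/-- The basis of the twisted group algebra. -/
noncomputable def twistedBasis : BicharBasis k G (twistedAlgebra k β hl hr) where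
  basis := Basis.mk
    (v := fun a => (⟨twistedShift k β a, Submodule.subset_span ⟨a, rfl⟩⟩ : twistedAlgebra k β hl hr))
    (LinearIndependent.of_comp (twistedAlgebra k β hl hr).val.toLinearMap
      (linearIndependent_twistedShift k β hr))
    (by
      rintro ⟨x, hx⟩ -
      have hx' : x ∈ (Submodule.span k (Set.range fun a =>
          (⟨twistedShift k β a, Submodule.subset_span ⟨a, rfl⟩⟩ : twistedAlgebra k β hl hr))).map
          (twistedAlgebra k β hl hr).val.toLinearMap := by
        rw [Submodule.map_span, ← Set.range_comp]
        exact hx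
      obtain ⟨y, hy, rfl⟩ := hx'
      exact hy)
  bichar := β
  bichar_add_left := hl
  bichar_add_right := hr
  mul_basis a b := by
    simp only [Basis.mk_apply]
    exact Subtype.ext (twistedShift_mul k β hl hr a b)

end TwistedTorus

/-! ### The skew polynomial ring as a positive part -/

section SkewPolyRing

variable {k : Type*} [Field k] {n : ℕ} (P : Matrix (Fin n) (Fin n) kˣ)

/-- The bicharacter on `ℤⁿ` with `β(e_j, e_i) = p_{ij}` for `i < j`, and `1` for `i ≥ j`. -/
def skewBichar (a b : Fin n → ℤ) : kˣ :=
  ∏ i, ∏ j, if i < j then P i j ^ (a j * b i) else 1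

theorem skewBichar_add_left (a b c : Fin n → ℤ) :
    skewBichar P (a + b) c = skewBichar P a c * skewBichar P b c := by
  simp only [skewBichar, ← Finset.prod_mul_distrib]
  refine Finset.prod_congr rfl fun i _ => Finset.prod_congr rfl fun j _ => ?_
  split_ifs
  · rw [Pi.add_apply, add_mul, zpow_add]
  · simp

theorem skewBichar_add_right (a b c : Fin n → ℤ) :
    skewBichar P a (b + c) = skewBichar P a b * skewBichar P a c := by
  simp only [skewBichar, ← Finset.prod_mul_distrib]
  refine Finset.prod_congr rfl fun i _ => Finset.prod_congr rfl fun j _ => ?_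
  split_ifs
  · rw [Pi.add_apply, mul_add, zpow_add]
  · simp

theorem skewBichar_single (i j : Fin n) :
    skewBichar P (Pi.single j 1) (Pi.single i 1) = if i < j then P i j else 1 := by
  rw [skewBichar, Finset.prod_eq_single i, Finset.prod_eq_single j]
  · simp
  · intro b _ hb
    simp [hb]
  · simp
  · intro b _ hb
    simp [hb]
  · simp

/-- The quantum torus containing the skew polynomial ring. -/
noncomputable abbrev quantumTorus : Subalgebra k (Module.End k ((Fin n → ℤ) →₀ k)) :=
  twistedAlgebra k (skewBichar P) (skewBichar_add_left P) (skewBichar_add_right P)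

/-- The monomial basis of the quantum torus. -/
noncomputable abbrev torusBasis : BicharBasis k (Fin n → ℤ) (quantumTorus P) :=
  twistedBasis k (skewBichar P) (skewBichar_add_left P) (skewBichar_add_right P)

theorem torusBasis_comm (hdiag : ∀ i, P i i = 1) (hP : ∀ i j, P i j * P j i = 1) (i j : Fin n) :
    (torusBasis P).basis (Pi.single j 1) * (torusBasis P).basis (Pi.single i 1) =
      (P i j : k) • ((torusBasis P).basis (Pi.single i 1) *
        (torusBasis P).basis (Pi.single j 1)) := by
  rw [(torusBasis P).mul_basis, (torusBasis P).mul_basis, smul_smul, add_comm (Pi.single j 1),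
    ← Units.val_mul]
  congr 2
  change skewBichar P _ _ = P i j * skewBichar P _ _
  rw [skewBichar_single, skewBichar_single]
  rcases lt_trichotomy i j with h | rfl | h
  · simp [h, h.not_gt]
  · simp [hdiag]
  · simp [h, h.not_gt, hP]

/-- The embedding of the skew polynomial ring in the quantum torus. -/
noncomputable def toQuantumTorus (hdiag : ∀ i, P i i = 1) (hP : ∀ i j, P i j * P j i = 1) :
    SkewPolyRing k P →ₐ[k] quantumTorus P :=
  RingQuot.liftAlgHom k
    ⟨FreeAlgebra.lift k fun i => (torusBasis P).basis (Pi.single i 1), by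
      rintro _ _ ⟨i, j⟩
      simpa using torusBasis_comm P hdiag hP i j⟩

/-- The generators of the skew polynomial ring. -/
noncomputable def skewVar (i : Fin n) : SkewPolyRing k P :=
  RingQuot.mkAlgHom k (SkewPolyRel P) (FreeAlgebra.ι k i)

theorem toQuantumTorus_skewVar (hdiag : ∀ i, P i i = 1) (hP : ∀ i j, P i j * P j i = 1)
    (i : Fin n) : toQuantumTorus P hdiag hP (skewVar P i) =
      (torusBasis P).basis (Pi.single i 1) := by
  simp [toQuantumTorus, skewVar]

theorem skewVar_mul_skewVar (i j : Fin n) :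
    skewVar P j * skewVar P i = (P i j : k) • (skewVar P i * skewVar P j) := by
  simpa [skewVar] using RingQuot.mkAlgHom_rel k (SkewPolyRel.comm (P := P) i j)

/-- The word in the generators given by a list of indices. -/
noncomputable def skewWord (l : List (Fin n)) : SkewPolyRing k P := (l.map (skewVar P)).prod

theorem skewWord_perm {l l' : List (Fin n)} (h : l.Perm l') :
    ∃ u : kˣ, skewWord P l = (u : k) • skewWord P l' := by
  induction h with
  | nil => exact ⟨1, by simp⟩
  | cons x _ ih =>
    obtain ⟨u, hu⟩ := ih
    refine ⟨u, ?_⟩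
    simp only [skewWord, List.map_cons, List.prod_cons] at hu ⊢
    rw [hu, mul_smul_comm]
  | swap x y l =>
    refine ⟨P x y, ?_⟩
    simp only [skewWord, List.map_cons, List.prod_cons, ← mul_assoc]
    rw [skewVar_mul_skewVar, smul_mul_assoc]
  | trans _ _ ih₁ ih₂ =>
    obtain ⟨u, hu⟩ := ih₁
    obtain ⟨v, hv⟩ := ih₂
    exact ⟨u * v, by rw [hu, hv, smul_smul, Units.val_mul]⟩

theorem span_skewWord : Submodule.span k (Set.range (skewWord P)) = ⊤ := by
  let A : Subalgebra k (SkewPolyRing k P) :=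
    (Submodule.span k (Set.range (skewWord P))).toSubalgebra
      (Submodule.subset_span ⟨[], by simp [skewWord]⟩) (by
        intro x y hx hy
        have := Submodule.mul_mem_mul hx hy
        rw [Submodule.span_mul_span] at this
        refine Submodule.span_mono ?_ this
        rintro _ ⟨_, ⟨a, rfl⟩, _, ⟨b, rfl⟩, rfl⟩
        exact ⟨a ++ b, by simp [skewWord]⟩)
  rw [eq_top_iff]
  rintro x -
  obtain ⟨y, rfl⟩ := RingQuot.mkAlgHom_surjective k (SkewPolyRel P) x
  change _ ∈ A
  induction y using FreeAlgebra.induction with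
  | grade0 r => rw [AlgHom.commutes]; exact A.algebraMap_mem r
  | grade1 i => exact Submodule.subset_span ⟨[i], by simp [skewWord, skewVar]⟩
  | mul a b ha hb => rw [map_mul]; exact A.mul_mem ha hb
  | add a b ha hb => rw [map_add]; exact A.add_mem ha hb

/-- The exponent of a word. -/
def wordExp (l : List (Fin n)) : Fin n → ℕ := fun i => l.count i

theorem wordExp_surjective : Function.Surjective (wordExp (n := n)) := by
  intro c
  refine ⟨(Finsupp.toMultiset (Finsupp.equivFunOnFinite.symm c)).toList, funext fun i => ?_⟩
  rw [wordExp, ← Multiset.coe_count, Multiset.coe_toList, Finsupp.count_toMultiset]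
  simp

theorem toQuantumTorus_skewWord (hdiag : ∀ i, P i i = 1) (hP : ∀ i j, P i j * P j i = 1)
    (l : List (Fin n)) : ∃ u : kˣ, toQuantumTorus P hdiag hP (skewWord P l) =
      (u : k) • (torusBasis P).basis (BicharBasis.natExp n (wordExp l)) := by
  induction l with
  | nil =>
    refine ⟨1, ?_⟩
    have : wordExp (n := n) [] = 0 := by ext; simp [wordExp]
    rw [this, map_zero, (torusBasis P).basis_zero]
    simp [skewWord]
  | cons i l ih =>
    obtain ⟨u, hu⟩ := ih
    have h : BicharBasis.natExp n (wordExp (i :: l)) =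
        Pi.single i 1 + BicharBasis.natExp n (wordExp l) := by
      ext j
      by_cases hij : j = i
      · subst hij
        simp [BicharBasis.natExp, wordExp, add_comm]
      · simp [BicharBasis.natExp, wordExp, hij, Ne.symm hij]
    refine ⟨u * (torusBasis P).bichar (Pi.single i 1) (BicharBasis.natExp n (wordExp l)), ?_⟩
    rw [h, Units.val_mul, mul_smul, ← (torusBasis P).mul_basis, ← mul_smul_comm, ← hu,
      ← toQuantumTorus_skewVar P hdiag hP, ← map_mul]
    simp [skewWord]

/-- One word per exponent spans, since permuting a word only rescales it. The images are unit
multiples of distinct torus monomials, hence independent, so these words form a basis and the map is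
injective. -/
theorem isPositivePart_toQuantumTorus (hdiag : ∀ i, P i i = 1) (hP : ∀ i j, P i j * P j i = 1) :
    (torusBasis P).IsPositivePart (toQuantumTorus P hdiag hP) := by
  choose w hw using wordExp_surjective (n := n)
  choose u hu using toQuantumTorus_skewWord P hdiag hP
  have hmk : ∀ l, ∃ v : kˣ, skewWord P l = (v : k) • skewWord P (w (wordExp l)) := fun l =>
    skewWord_perm P (List.perm_iff_count.mpr fun i => (congr_fun (hw (wordExp l)) i).symm)
  have hspan : ⊤ ≤ Submodule.span k (Set.range fun c => skewWord P (w c)) := by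
    rw [← span_skewWord P, Submodule.span_le]
    rintro _ ⟨l, rfl⟩
    obtain ⟨v, hv⟩ := hmk l
    rw [hv]
    exact Submodule.smul_mem _ _ (Submodule.subset_span ⟨_, rfl⟩)
  have himage : ∀ c, toQuantumTorus P hdiag hP (skewWord P (w c)) =
      (u (w c) : k) • (torusBasis P).basis (BicharBasis.natExp n c) := fun c => by
    rw [hu, hw]
  have hli : LinearIndependent k fun c => toQuantumTorus P hdiag hP (skewWord P (w c)) := by
    simp only [himage]
    exact ((torusBasis P).basis.linearIndependent.comp _
      BicharBasis.natExp_injective).units_smul fun c => u (w c)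
  let b : Basis (Fin n → ℕ) k (SkewPolyRing k P) :=
    Basis.mk (LinearIndependent.of_comp (toQuantumTorus P hdiag hP).toLinearMap hli) hspan
  have hb : ∀ c, b c = skewWord P (w c) := fun c => Basis.mk_apply _ _ c
  constructor
  · refine (injective_iff_map_eq_zero _).mpr fun x hx => ?_
    rw [← b.linearCombination_repr x, Finsupp.linearCombination_apply, Finsupp.sum] at hx
    simp only [map_sum, map_smul, hb] at hx
    refine b.repr.map_eq_zero_iff.mp (Finsupp.ext fun c => ?_)
    by_contra hc
    exact hc (linearIndependent_iff'.mp hli _ _ hx c (Finsupp.mem_support_iff.mpr hc))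
  · intro t
    constructor
    · rintro ⟨x, rfl⟩ a ha
      rw [← b.linearCombination_repr x, Finsupp.linearCombination_apply, Finsupp.sum] at ha
      simp only [map_sum, map_smul, hb, himage, Finsupp.finsetSum_apply] at ha
      obtain ⟨c, -, hc⟩ := Finset.exists_ne_zero_of_sum_ne_zero ha
      have : BicharBasis.natExp n c = a := by
        by_contra hne
        simp [hne] at hc
      exact this ▸ BicharBasis.natExp_nonneg c
    · intro ht
      suffices t ∈ LinearMap.range (toQuantumTorus P hdiag hP).toLinearMap from this
      rw [← (torusBasis P).basis.linearCombination_repr t]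
      refine Submodule.sum_mem _ fun a ha => Submodule.smul_mem _ _ ?_
      obtain ⟨c, rfl⟩ := BicharBasis.exists_natExp (ht a (by simpa using ha))
      refine ⟨((u (w c))⁻¹ : kˣ) • skewWord P (w c), ?_⟩
      rw [Units.smul_def, map_smul, AlgHom.toLinearMap_apply, himage, smul_smul, ← Units.val_mul,
        inv_mul_cancel, Units.val_one, one_smul]

end SkewPolyRing

theorem proposition5p4 {k : Type*} [Field k] (n : ℕ) (P : Matrix (Fin n) (Fin n) kˣ)
    (hdiag : ∀ i, P i i = 1) (hP : ∀ i j, P i j * P j i = 1) :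
    IsNoetherianUFR (SkewPolyRing k P) :=
  (isPositivePart_toQuantumTorus P hdiag hP).isNoetherianUFR
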